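/- Let $\Gamma=(X,R)$ be a finite connected bipartite distance-regular graph with path-length distance $\partial$, even diameter $D\ge 4$, valency $k\ge 3$ and intersection numbers $p^h_{ij}=|\{z\in X:\partial(x,z)=i,\ \partial(z,y)=j\}|$ (for $\partial(x,y)=h$); put $b_i=p^i_{1,i+1}$ $(0\le i\le D-1)$ and $d=D/2$. For $0\le i\le D$ let $A_i\in \mathrm{Mat}_X(\mathbb C)$ be the $i$-th distance matrix, and let $A=A_1$ be the adjacency matrix. Let $\theta_0>\theta_1>\cdots>\theta_D$ be the distinct eigenvalues of $A$, and let $E_i$ be the primitive idempotent associated with $\theta_i$, i.e. the polynomial in $A$ that acts as $1$ on the $\theta_i$-eigenspace of $A$ and as $0$ on the other eigenspaces. Let $M$ be the subalgebra of $\mathrm{Mat}_X(\mathbb C)$ generated by $A$. Fix $x\in X$; for $0\le i\le D$ let $E_i^*$ be the diagonal matrix with $(y,y)$-entry $1$ if $\partial(x,y)=i$ and $0$ otherwise, and let $T$ be the subalgebra of $\mathrm{Mat}_X(\mathbb C)$ generated by $M$ and $E_0^*,\dots,E_D^*$. A $T$-module is a subspace $W\subseteq\mathbb C^X$ with $TW\subseteq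 W$; it is irreducible if $W\neq 0$ and $W$ contains no $T$-modules other than $0$ and $W$. An irreducible $T$-module $W$ is thin if $\dim E_i^*W\le 1$ for $0\le i\le D$, and its endpoint is $\min\{i: 0\le i\le D,\ E_i^*W\ne 0\}$. If $W$ is thin and irreducible with endpoint $2$, its local eigenvalue is the scalar by which $E_2^*A_2E_2^*$ acts on the one-dimensional space $E_2^*W$. For $z\in\mathbb C\cup\{\infty\}$ put $\tilde z=-1-\frac{b_2b_3}{z^2-b_2}$ if $z\neq\infty$ and $z^2\ne b_2$, $\tilde z=\infty$ if $z^2=b_2$, and $\tilde z=-1$ if $z=\infty$. Let $W$ be a thin irreducible $T$-module with endpoint $2$ and local eigenvalue $\tilde\theta_d$. Then: (i) $\dim W=D-2$. (ii) For $0\le i\le D$, $E_i^*W=0$ if $i\in\{0,1,D\}$, and $\dim E_i^*W=1$ if $2\le i\le D-1$. (iii) For $0\le i\le D$, $E_iW=0$ if $i\in\{0,d,D\}$, and $\dim E_iW=1$ if $1\le i\le D-1$ and $i\ne d$. (iv) For every nonzero $v\in E_2^*W$ we have $W=Mv$, the vectors $E_iv$ $(1\le i\le D-1,\ i\neq d)$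 form a basis of $W$, and $E_0v=E_dv=E_Dv=0$. -/

import Mathlib

open scoped Matrix OnePoint

noncomputable section

namespace BipartiteDRG

variable {X : Type*} [Fintype X] [DecidableEq X]

/-- `Γ` is distance-regular (finite, connected) with intersection numbers
`p h i j = p^h_{ij}` for `0 ≤ h, i, j ≤ D`, where `D = Γ.diam`. -/
structure IsDistanceRegularWith (Γ : SimpleGraph X) (p : ℕ → ℕ → ℕ → ℕ) : Prop where
  connected : Γ.Connected
  card_eq : ∀ h i j : ℕ, h ≤ Γ.diam → i ≤ Γ.diam → j ≤ Γ.diam → ∀ x y : X, Γ.dist x y = h →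
    (Finset.univ.filter fun z : X => Γ.dist x z = i ∧ Γ.dist z y = j).card = p h i j

/-- `b_i = p^i_{1,i+1}` for `0 ≤ i ≤ D - 1`, and `b_D = 0`. -/
def bNum (Γ : SimpleGraph X) (p : ℕ → ℕ → ℕ → ℕ) (i : ℕ) : ℕ :=
  if i < Γ.diam then p i 1 (i + 1) else 0

/-- The `i`-th distance matrix `A_i`. -/
def distMatrix (Γ : SimpleGraph X) (i : ℕ) : Matrix X X ℂ :=
  Matrix.of fun y z => if Γ.dist y z = i then 1 else 0

/-- The adjacency matrix `A = A_1`. -/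
def adjM (Γ : SimpleGraph X) : Matrix X X ℂ := distMatrix Γ 1

/-- The Bose–Mesner algebra `M`, generated by `A`. -/
def boseMesner (Γ : SimpleGraph X) : Subalgebra ℂ (Matrix X X ℂ) :=
  Algebra.adjoin ℂ {adjM Γ}

/-- The finite set of (real) eigenvalues of the symmetric matrix `A`. -/
def eigSet (Γ : SimpleGraph X) : Finset ℝ :=
  (Matrix.finite_real_spectrum (A := adjM Γ)).toFinset

/-- The distinct eigenvalues `θ_0 > θ_1 > ⋯` of `A` in decreasing order
(value `0` beyond the last one). -/
def theta (Γ : SimpleGraph X) (i : ℕ) : ℝ :=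
  ((eigSet Γ).sort (· ≥ ·)).getD i 0

/-- The primitive idempotent `E_i ∈ M` associated with `θ_i`:
`E_i = ∏_{θ ≠ θ_i} (A - θ I) / (θ_i - θ)`, the product over the other eigenvalues of `A`;
it acts as `1` on the `θ_i`-eigenspace of `A` and as `0` on all other eigenspaces. -/
def primIdem (Γ : SimpleGraph X) (i : ℕ) : Matrix X X ℂ :=
  Polynomial.aeval (adjM Γ) (Lagrange.basis (eigSet Γ) id (theta Γ i))

/-- The dual idempotent `E_i^*` with respect to `x`. -/
def dualIdem (Γ : SimpleGraph X) (x : X) (i : ℕ) : Matrix X X ℂ :=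
  Matrix.diagonal fun y => if Γ.dist x y = i then 1 else 0

/-- The dual Bose–Mesner algebra `M^*` with respect to `x`. -/
def dualBoseMesner (Γ : SimpleGraph X) (x : X) : Subalgebra ℂ (Matrix X X ℂ) :=
  Algebra.adjoin ℂ {B | ∃ i ≤ Γ.diam, B = dualIdem Γ x i}

/-- The subconstituent algebra `T` with respect to `x`, generated by `M` and `M^*`. -/
def subconstituentAlgebra (Γ : SimpleGraph X) (x : X) : Subalgebra ℂ (Matrix X X ℂ) :=
  boseMesner Γ ⊔ dualBoseMesner Γ x

/-- The subspace `BW = {Bw | w ∈ W}`. -/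
def act (B : Matrix X X ℂ) (W : Submodule ℂ (X → ℂ)) : Submodule ℂ (X → ℂ) :=
  W.map B.mulVecLin

/-- `W ⊆ V = ℂ^X` is a `T`-module. -/
def IsTModule (Γ : SimpleGraph X) (x : X) (W : Submodule ℂ (X → ℂ)) : Prop :=
  ∀ B ∈ subconstituentAlgebra Γ x, ∀ w ∈ W, B *ᵥ w ∈ W

/-- `W` is an irreducible `T`-module. -/
structure IsIrreducibleTModule (Γ : SimpleGraph X) (x : X) (W : Submodule ℂ (X → ℂ)) : Prop where
  isTModule : IsTModule Γ x W
  ne_bot : W ≠ ⊥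
  eq_bot_or_eq : ∀ W' : Submodule ℂ (X → ℂ), W' ≤ W → IsTModule Γ x W' → W' = ⊥ ∨ W' = W

/-- `W` is thin: every `E_i^* W` has dimension at most `1`. -/
def IsThin (Γ : SimpleGraph X) (x : X) (W : Submodule ℂ (X → ℂ)) : Prop :=
  ∀ i ≤ Γ.diam, Module.finrank ℂ (act (dualIdem Γ x i) W) ≤ 1

/-- The endpoint `min {i | 0 ≤ i ≤ D, E_i^* W ≠ 0}` of a nonzero `T`-module `W`. -/
def endpoint (Γ : SimpleGraph X) (x : X) (W : Submodule ℂ (X → ℂ)) : ℕ :=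
  sInf {i | i ≤ Γ.diam ∧ act (dualIdem Γ x i) W ≠ ⊥}

/-- `η` is the local eigenvalue of `W` (a thin irreducible `T`-module with endpoint 2):
the nonzero space `E_2^* W` consists of eigenvectors of `E_2^* A_2 E_2^*` for `η`. -/
def HasLocalEigenvalue (Γ : SimpleGraph X) (x : X) (W : Submodule ℂ (X → ℂ)) (η : ℂ) : Prop :=
  act (dualIdem Γ x 2) W ≠ ⊥ ∧ ∀ w ∈ act (dualIdem Γ x 2) W,
    (dualIdem Γ x 2 * distMatrix Γ 2 * dualIdem Γ x 2) *ᵥ w = η • w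

/-- The map `z ↦ z̃` on `ℂ ∪ {∞}`: `z̃ = -1 - b_2 b_3 / (z² - b_2)` for finite `z` with
`z² ≠ b_2`, `z̃ = ∞` if `z² = b_2`, and `∞̃ = -1`. -/
def tilde (Γ : SimpleGraph X) (p : ℕ → ℕ → ℕ → ℕ) : OnePoint ℂ → OnePoint ℂ
  | ∞ => ((-1 : ℂ) : OnePoint ℂ)
  | OnePoint.some z =>
    if z ^ 2 = (bNum Γ p 2 : ℂ) then ∞
    else ((-1 - (bNum Γ p 2 : ℂ) * (bNum Γ p 3 : ℂ) / (z ^ 2 - (bNum Γ p 2 : ℂ)) : ℂ) : OnePoint ℂ)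

/-! The matrices `E_i` are the orthogonal idempotents of the decomposition `A = ∑ θ_i E_i`. -/

theorem adjM_isSelfAdjoint (Γ : SimpleGraph X) : IsSelfAdjoint (adjM Γ) := by
  ext y z
  simp only [adjM, distMatrix, Matrix.star_apply, Matrix.of_apply, Γ.dist_comm (u := z)]
  split_ifs <;> simp

theorem aeval_adjM_congr (Γ : SimpleGraph X) {q r : Polynomial ℝ}
    (h : ∀ t ∈ eigSet Γ, q.eval t = r.eval t) :
    Polynomial.aeval (adjM Γ) q = Polynomial.aeval (adjM Γ) r := by
  rw [← cfc_polynomial q (adjM Γ) (adjM_isSelfAdjoint Γ),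
    ← cfc_polynomial r (adjM Γ) (adjM_isSelfAdjoint Γ)]
  exact cfc_congr fun t ht => h t (by simpa [eigSet] using ht)

theorem theta_mem (Γ : SimpleGraph X) {i : ℕ} (hi : i < (eigSet Γ).card) :
    theta Γ i ∈ eigSet Γ := by
  have hl : i < ((eigSet Γ).sort (· ≥ ·)).length := by simpa using hi
  rw [theta, List.getD_eq_getElem _ _ hl]
  exact (Finset.mem_sort (· ≥ ·)).1 (List.getElem_mem hl)

theorem theta_strictAnti (Γ : SimpleGraph X) {i j : ℕ} (hij : i < j)
    (hj : j < (eigSet Γ).card) : theta Γ j < theta Γ i := by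
  have hl : j < ((eigSet Γ).sort (· ≥ ·)).length := by simpa using hj
  rw [theta, theta, List.getD_eq_getElem _ _ hl, List.getD_eq_getElem _ _ (hij.trans hl)]
  refine lt_of_le_of_ne
    (List.pairwise_iff_getElem.1 (Finset.pairwise_sort _ (· ≥ ·)) i j _ _ hij) fun h => ?_
  exact hij.ne' ((Finset.sort_nodup _ (· ≥ ·)).getElem_inj_iff.1 h)

theorem adjM_mul_primIdem (Γ : SimpleGraph X) (i : ℕ) :
    adjM Γ * primIdem Γ i = theta Γ i • primIdem Γ i := by
  have key := aeval_adjM_congr Γ (q := Polynomial.X * Lagrange.basis (eigSet Γ) id (theta Γ i))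
    (r := theta Γ i • Lagrange.basis (eigSet Γ) id (theta Γ i)) (fun t ht => by
      by_cases h : t = theta Γ i
      · subst h; simp
      · have := Lagrange.eval_basis_of_ne (F := ℝ) (v := id) (i := theta Γ i) (Ne.symm h) ht
        simp only [id] at this
        simp [this])
  simpa [primIdem] using key

theorem primIdem_mul_primIdem (Γ : SimpleGraph X) {i j : ℕ} (hi : i < (eigSet Γ).card)
    (hj : j < (eigSet Γ).card) :
    primIdem Γ i * primIdem Γ j = if i = j then primIdem Γ i else 0 := by
  have hself := Lagrange.eval_basis_self (F := ℝ) (v := id) (s := eigSet Γ)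
    (Set.injOn_id _) (theta_mem Γ hi)
  have hne := fun t (ht : t ∈ eigSet Γ) k (h : theta Γ k ≠ t) =>
    Lagrange.eval_basis_of_ne (F := ℝ) (v := id) (i := theta Γ k) h ht
  simp only [id] at hself hne
  have key := aeval_adjM_congr Γ
    (q := Lagrange.basis (eigSet Γ) id (theta Γ i) * Lagrange.basis (eigSet Γ) id (theta Γ j))
    (r := if i = j then Lagrange.basis (eigSet Γ) id (theta Γ i) else 0) (fun t ht => by
      by_cases h : theta Γ i = t
      · subst h
        split_ifs with hij
        · subst hij; simp [hself]
        · have : theta Γ j ≠ theta Γ i := by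
            rcases lt_or_gt_of_ne hij with h | h
            · exact (theta_strictAnti Γ h hj).ne
            · exact (theta_strictAnti Γ h hi).ne'
          simp [hne _ ht j this]
      · split_ifs <;> simp [hne t ht i h])
  rw [map_mul] at key
  rw [primIdem, primIdem, key]
  split_ifs <;> simp

theorem sum_primIdem (Γ : SimpleGraph X) :
    ∑ i ∈ Finset.range (eigSet Γ).card, primIdem Γ i = 1 := by
  have hsum : ∑ i ∈ Finset.range (eigSet Γ).card, primIdem Γ i =
      ∑ t ∈ eigSet Γ, Polynomial.aeval (adjM Γ) (Lagrange.basis (eigSet Γ) id t) := by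
    refine Finset.sum_nbij (theta Γ) (fun i hi => theta_mem Γ (Finset.mem_range.1 hi)) ?_ ?_
      (fun i _ => rfl)
    · intro i hi j hj hij
      rcases lt_trichotomy i j with h | h | h
      · exact absurd hij (theta_strictAnti Γ h (by simpa using hj)).ne'
      · exact h
      · exact absurd hij (theta_strictAnti Γ h (by simpa using hi)).ne
    · intro t ht
      obtain ⟨i, hi, h⟩ := List.mem_iff_getElem.1
        ((Finset.mem_sort (s := eigSet Γ) (· ≥ ·)).2 ht)
      refine ⟨i, by simpa using hi, ?_⟩
      rw [theta, List.getD_eq_getElem _ _ hi, h]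
  rw [hsum, ← map_sum]
  rcases (eigSet Γ).eq_empty_or_nonempty with h | h
  · exact (aeval_adjM_congr Γ (r := 1) (by simp [h])).trans (map_one _)
  · rw [Lagrange.sum_basis (Set.injOn_id _) h, map_one]

end BipartiteDRG

end

noncomputable section

namespace BipartiteDRG

set_option linter.unusedSectionVars false

variable {X : Type*} {Γ : SimpleGraph X}

/-! ### Distances in a bipartite distance-regular graph -/

/-! Write k for the valency. The spectrum of a bipartite graph is symmetric about 0, and A has
exactly D + 1 eigenvalues, so the middle one θ_d is 0, the extreme ones are ±k, and the prescribed
local eigenvalue is b_3 - 1.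

Take a nonzero v in E_2^*W. Since E_0^*W = 0, the entries of v sum to zero. The entries of E_i
depend only on distance, say through values s_0, ..., s_D, and vertices of the second subconstituent
lie at mutual distance 0, 2 or 4. Hence E_i v restricted there is f v with f = s_0 + η s_2 - (1 + η)
s_4. For η = b_3 - 1 the three-term recurrence coming from A E_i = θ_i E_i gives k b_1 b_2 f =
θ_i²(k² - θ_i²) s_0 with s_0 ≠ 0. As ‖E_i v‖² = f ‖v‖², the vector E_i v vanishes exactly for i = 0,
d, D (`primIdem_mulVec_eq_zero_iff`).

On the other side, thinness and irreducibility make W the span of the raised vectors R^j v, and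
these lie in Mv (`span_raise`, `exists_boseMesner_mulVec_eq`). So the D - 2 nonzero vectors E_i v
form a basis of W. The nonzero R^j v form another basis, with one vector in each E_{j+2}^*W, and the
dimension D - 2 fixes where the sequence stops. -/

theorem even_dist_iff (hconn : Γ.Connected) (c : Γ.Coloring Bool) (y z : X) :
    Even (Γ.dist y z) ↔ (c y ↔ c z) := by
  obtain ⟨w, hw⟩ := hconn.exists_walk_length_eq_dist y z
  rw [← hw, c.even_length_iff_congr w]

theorem exists_boolColoring (hbip : Γ.IsBipartite) : Nonempty (Γ.Coloring Bool) :=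
  Nonempty.map (Γ.recolorOfEquiv finTwoEquiv) hbip

theorem even_dist_add_dist_iff (hconn : Γ.Connected) (hbip : Γ.IsBipartite) (x y z : X) :
    Even (Γ.dist x y + Γ.dist x z) ↔ Even (Γ.dist y z) := by
  obtain ⟨c⟩ := exists_boolColoring hbip
  rw [Nat.even_add, even_dist_iff hconn c, even_dist_iff hconn c, even_dist_iff hconn c]
  tauto

theorem dist_of_adj (hconn : Γ.Connected) (hbip : Γ.IsBipartite) (x : X) {y z : X}
    (h : Γ.Adj y z) : Γ.dist x z = Γ.dist x y + 1 ∨ Γ.dist x y = Γ.dist x z + 1 := by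
  have h1 := SimpleGraph.dist_eq_one_iff_adj.2 h
  have h2 := hconn.dist_triangle (u := x) (v := y) (w := z)
  have h3 := hconn.dist_triangle (u := x) (v := z) (w := y)
  rw [Γ.dist_comm (u := z)] at h3
  have h4 := even_dist_add_dist_iff hconn hbip x y z
  rw [h1] at h4 h2 h3
  have h5 : ¬ Even (Γ.dist x y + Γ.dist x z) := by rw [h4]; decide
  rcases Nat.lt_or_ge (Γ.dist x y) (Γ.dist x z) with h | h
  · omega
  · right
    by_contra h6
    exact h5 ⟨Γ.dist x y, by omega⟩

variable [Fintype X] [DecidableEq X]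

theorem adjM_apply (y z : X) [Decidable (Γ.Adj y z)] :
    adjM Γ y z = if Γ.Adj y z then 1 else 0 := by
  simp only [adjM, distMatrix, Matrix.of_apply, SimpleGraph.dist_eq_one_iff_adj]

theorem dist_le_diam_of_connected (hconn : Γ.Connected) (y z : X) : Γ.dist y z ≤ Γ.diam := by
  have := hconn.nonempty
  exact SimpleGraph.dist_le_diam (SimpleGraph.connected_iff_ediam_ne_top.1 hconn)

/-- A geodesic of maximal length. -/
theorem exists_geodesic (hconn : Γ.Connected) :
    ∃ (y : X) (z : ℕ → X), (∀ j ≤ Γ.diam, Γ.dist y (z j) = j) ∧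
      ∀ j < Γ.diam, Γ.Adj (z j) (z (j + 1)) := by
  have := hconn.nonempty
  obtain ⟨u, v, huv⟩ := SimpleGraph.exists_dist_eq_diam (G := Γ)
  obtain ⟨w, hw⟩ := hconn.exists_walk_length_eq_dist u v
  refine ⟨u, w.getVert, fun j hj => ?_, fun j hj => w.adj_getVert_succ (by omega)⟩
  have h1 := SimpleGraph.dist_le (w.take j)
  have h2 := SimpleGraph.dist_le (w.drop j)
  have h3 := hconn.dist_triangle (u := u) (v := w.getVert j) (w := v)
  rw [SimpleGraph.Walk.take_length] at h1
  rw [SimpleGraph.Walk.drop_length] at h2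
  omega

variable {p : ℕ → ℕ → ℕ → ℕ}

theorem bNum_of_lt {j : ℕ} (hj : j < Γ.diam) : bNum Γ p j = p j 1 (j + 1) := if_pos hj

theorem bNum_pos (hΓ : IsDistanceRegularWith Γ p) {j : ℕ} (hj : j < Γ.diam) :
    0 < bNum Γ p j := by
  obtain ⟨y, z, hz, hadj⟩ := exists_geodesic hΓ.connected
  rw [bNum_of_lt hj, ← hΓ.card_eq j 1 (j + 1) hj.le (by omega) hj (z j) y
    (by rw [Γ.dist_comm, hz j hj.le]), Finset.card_pos]
  refine ⟨z (j + 1), ?_⟩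
  simp only [Finset.mem_filter, Finset.mem_univ, true_and, SimpleGraph.dist_eq_one_iff_adj]
  exact ⟨hadj j hj, by rw [Γ.dist_comm, hz _ hj]⟩

theorem cNum_pos (hΓ : IsDistanceRegularWith Γ p) {j : ℕ} (hj : j + 1 ≤ Γ.diam) :
    0 < p (j + 1) 1 j := by
  obtain ⟨y, z, hz, hadj⟩ := exists_geodesic hΓ.connected
  rw [← hΓ.card_eq (j + 1) 1 j hj (by omega) (by omega) (z (j + 1)) y
    (by rw [Γ.dist_comm, hz _ hj]), Finset.card_pos]
  refine ⟨z j, ?_⟩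
  simp only [Finset.mem_filter, Finset.mem_univ, true_and, SimpleGraph.dist_eq_one_iff_adj]
  exact ⟨(hadj j hj).symm, by rw [Γ.dist_comm, hz _ (by omega)]⟩

/-- Summing a function of the distance to `z` over the neighbours of `y`. -/
theorem sum_adjM_mul (hΓ : IsDistanceRegularWith Γ p) (hbip : Γ.IsBipartite) {j : ℕ}
    (hj : j < Γ.diam) {y z : X} (hyz : Γ.dist y z = j) (f : ℕ → ℂ) :
    ∑ w, adjM Γ y w * f (Γ.dist w z) = p j 1 (j - 1) * f (j - 1) + bNum Γ p j * f (j + 1) := by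
  rw [bNum_of_lt hj, ← hΓ.card_eq j 1 (j - 1) hj.le (by omega) (by omega) y z hyz,
    ← hΓ.card_eq j 1 (j + 1) hj.le (by omega) (by omega) y z hyz, ← nsmul_eq_mul, ← nsmul_eq_mul,
    ← Finset.sum_const, ← Finset.sum_const, Finset.sum_filter, Finset.sum_filter,
    ← Finset.sum_add_distrib]
  refine Finset.sum_congr rfl fun w _ => ?_
  by_cases h : Γ.Adj y w
  · have h1 := SimpleGraph.dist_eq_one_iff_adj.2 h
    have h2 : adjM Γ y w = 1 := by simp [adjM, distMatrix, h1]
    have h3 := dist_of_adj hΓ.connected hbip z h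
    rw [Γ.dist_comm (u := z) (v := w), Γ.dist_comm (u := z) (v := y), hyz] at h3
    rcases h3 with h3 | h3
    · simp only [h1, h2, h3, true_and, one_mul, if_true]
      rw [if_neg (by omega), zero_add]
    · have h4 : Γ.dist w z = j - 1 := by omega
      simp only [h1, h2, h4, true_and, one_mul, if_true]
      rw [if_neg (show j - 1 ≠ j + 1 by omega), add_zero]
  · have h1 : Γ.dist y w ≠ 1 := fun h' => h (SimpleGraph.dist_eq_one_iff_adj.1 h')
    have h2 : adjM Γ y w = 0 := by simp [adjM, distMatrix, h1]
    simp [h1, h2]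

/-- With truncated subtraction, the lowering term of the recurrence at `j = 0` carries this
coefficient, so it drops out. -/
theorem p_zero_one_zero (hΓ : IsDistanceRegularWith Γ p) (hD : 1 ≤ Γ.diam) : p 0 1 0 = 0 := by
  obtain ⟨y⟩ := hΓ.connected.nonempty
  rw [← hΓ.card_eq 0 1 0 (by omega) hD (by omega) y y (by simp), Finset.card_eq_zero,
    Finset.filter_eq_empty_iff]
  rintro w - ⟨h1, h2⟩
  rw [Γ.dist_comm] at h2
  omega

theorem p_one_one_zero (hΓ : IsDistanceRegularWith Γ p) (hD : 1 ≤ Γ.diam) : p 1 1 0 = 1 := by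
  obtain ⟨y, z, hz, hadj⟩ := exists_geodesic hΓ.connected
  rw [← hΓ.card_eq 1 1 0 hD hD (by omega) y (z 1) (hz 1 hD), Finset.card_eq_one]
  refine ⟨z 1, ?_⟩
  ext w
  simp only [Finset.mem_filter, Finset.mem_univ, true_and, Finset.mem_singleton]
  constructor
  · rintro ⟨-, h⟩
    exact (hΓ.connected.dist_eq_zero_iff).1 h
  · rintro rfl
    exact ⟨hz 1 hD, by simp⟩

theorem sum_adjM (hΓ : IsDistanceRegularWith Γ p) (hbip : Γ.IsBipartite) (hD : 1 ≤ Γ.diam)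
    (y : X) : ∑ w, adjM Γ y w = bNum Γ p 0 := by
  have := sum_adjM_mul hΓ hbip (j := 0) hD (y := y) (z := y) (by simp) (fun _ => 1)
  simpa [p_zero_one_zero hΓ hD] using this

theorem cNum_add_bNum (hΓ : IsDistanceRegularWith Γ p) (hbip : Γ.IsBipartite) {j : ℕ}
    (hj : j < Γ.diam) : (p j 1 (j - 1) : ℂ) + bNum Γ p j = bNum Γ p 0 := by
  obtain ⟨y, z, hz, hadj⟩ := exists_geodesic hΓ.connected
  have h1 := sum_adjM_mul hΓ hbip hj (y := z j) (z := y) (by rw [Γ.dist_comm, hz j hj.le])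
    (fun _ => 1)
  simp only [mul_one] at h1
  rw [← h1, sum_adjM hΓ hbip (by omega)]

/-! ### Elements of the Bose–Mesner algebra as functions of the distance -/

theorem adjM_mem_boseMesner : adjM Γ ∈ boseMesner Γ :=
  Algebra.subset_adjoin rfl

theorem aeval_adjM_mem_boseMesner (q : Polynomial ℝ) :
    Polynomial.aeval (adjM Γ) q ∈ boseMesner Γ := by
  have h : Algebra.adjoin ℝ {adjM Γ} ≤ (boseMesner Γ).restrictScalars ℝ :=
    Algebra.adjoin_le (by rintro _ rfl; exact adjM_mem_boseMesner)
  exact h (Polynomial.aeval_mem_adjoin_singleton ℝ _)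

theorem primIdem_mem_boseMesner (i : ℕ) : primIdem Γ i ∈ boseMesner Γ :=
  aeval_adjM_mem_boseMesner _

/-- Products stay functions of the distance because the intersection numbers count the intermediate
vertices, independently of the chosen pair. -/
theorem exists_eq_of_mem_boseMesner (hΓ : IsDistanceRegularWith Γ p)
    {B : Matrix X X ℂ} (hB : B ∈ boseMesner Γ) :
    ∃ s : ℕ → ℂ, ∀ y z, B y z = s (Γ.dist y z) := by
  induction hB using Algebra.adjoin_induction with
  | mem B hB =>
    obtain rfl := hB
    exact ⟨fun j => if j = 1 then 1 else 0, fun y z => rfl⟩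
  | algebraMap r =>
    refine ⟨fun j => if j = 0 then r else 0, fun y z => ?_⟩
    simp only [Matrix.algebraMap_matrix_apply, Algebra.algebraMap_self, RingHom.id_apply,
      hΓ.connected.dist_eq_zero_iff]
  | add B C _ _ hB hC =>
    obtain ⟨s, hs⟩ := hB
    obtain ⟨t, ht⟩ := hC
    exact ⟨s + t, fun y z => by simp [hs, ht]⟩
  | mul B C _ _ hB hC =>
    obtain ⟨s, hs⟩ := hB
    obtain ⟨t, ht⟩ := hC
    refine ⟨fun h => ∑ i ∈ Finset.range (Γ.diam + 1), ∑ j ∈ Finset.range (Γ.diam + 1),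
      p h i j * (s i * t j), fun y z => ?_⟩
    have hle := dist_le_diam_of_connected hΓ.connected
    rw [Matrix.mul_apply]
    beta_reduce
    have h1 : ∀ i ∈ Finset.range (Γ.diam + 1), ∀ j ∈ Finset.range (Γ.diam + 1),
        (p (Γ.dist y z) i j : ℂ) * (s i * t j) =
          ∑ w, if Γ.dist y w = i ∧ Γ.dist w z = j then s i * t j else 0 := by
      intro i hi j hj
      rw [Finset.mem_range] at hi hj
      rw [← hΓ.card_eq _ i j (hle y z) (by omega) (by omega) y z rfl, ← nsmul_eq_mul,
        ← Finset.sum_const, Finset.sum_filter]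
    rw [Finset.sum_congr rfl fun i hi => Finset.sum_congr rfl (h1 i hi)]
    simp_rw [Finset.sum_comm (s := Finset.range (Γ.diam + 1)) (t := (Finset.univ : Finset X))]
    refine Finset.sum_congr rfl fun w _ => ?_
    rw [hs, ht, Finset.sum_eq_single (Γ.dist y w), Finset.sum_eq_single (Γ.dist w z)]
    · simp
    · intro j _ hj
      simp [hj.symm]
    · intro h
      exact absurd (Finset.mem_range.2 (Nat.lt_succ_of_le (hle w z))) h
    · intro i _ hi
      simp [hi.symm]
    · intro h
      exact absurd (Finset.mem_range.2 (Nat.lt_succ_of_le (hle y w))) h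

/-- The three-term recurrence for the values of a matrix `B` with `A B = t B`. -/
theorem three_term_recurrence (hΓ : IsDistanceRegularWith Γ p) (hbip : Γ.IsBipartite)
    {B : Matrix X X ℂ} {s : ℕ → ℂ} (hs : ∀ y z, B y z = s (Γ.dist y z)) {t : ℂ}
    (hB : adjM Γ * B = t • B) {j : ℕ} (hj : j < Γ.diam) :
    p j 1 (j - 1) * s (j - 1) + bNum Γ p j * s (j + 1) = t * s j := by
  obtain ⟨y, z, hz, hadj⟩ := exists_geodesic hΓ.connected
  have hd : Γ.dist (z j) y = j := by rw [Γ.dist_comm, hz j hj.le]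
  rw [← sum_adjM_mul hΓ hbip hj hd]
  have := congrFun (congrFun hB (z j)) y
  simp only [Matrix.mul_apply, hs, Matrix.smul_apply, smul_eq_mul, hd] at this
  exact this

/-- As b_j ≠ 0 for j < D, the recurrence determines all values from s_0. Applied to a primitive
idempotent, this makes its diagonal value nonzero. -/
theorem eq_zero_of_value_zero (hΓ : IsDistanceRegularWith Γ p) (hbip : Γ.IsBipartite)
    (hD : 1 ≤ Γ.diam)
    {B : Matrix X X ℂ} {s : ℕ → ℂ} (hs : ∀ y z, B y z = s (Γ.dist y z)) {t : ℂ}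
    (hB : adjM Γ * B = t • B) (h0 : s 0 = 0) : B = 0 := by
  have hb : ∀ j < Γ.diam, (bNum Γ p j : ℂ) ≠ 0 := fun j hj =>
    Nat.cast_ne_zero.2 (bNum_pos hΓ hj).ne'
  have key : ∀ j, j + 1 ≤ Γ.diam → s j = 0 ∧ s (j + 1) = 0 := by
    intro j
    induction j with
    | zero =>
      intro hj
      have := three_term_recurrence hΓ hbip hs hB (j := 0) hj
      simp only [h0, mul_zero, zero_add, Nat.zero_sub, mul_eq_zero, hb 0 hj, false_or] at this
      exact ⟨h0, this⟩
    | succ j ih =>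
      intro hj
      obtain ⟨h1, h2⟩ := ih (by omega)
      have := three_term_recurrence hΓ hbip hs hB (j := j + 1) hj
      simp only [Nat.add_sub_cancel, h1, h2, mul_zero, zero_add, mul_eq_zero, hb _ hj,
        false_or] at this
      exact ⟨h2, this⟩
  ext y z
  rw [hs]
  have hle := dist_le_diam_of_connected hΓ.connected y z
  rcases Nat.lt_or_ge (Γ.dist y z) Γ.diam with h | h
  · exact (key _ h).1
  · have h' : Γ.dist y z = Γ.diam - 1 + 1 := by omega
    rw [h']
    exact (key _ (by omega)).2

/-! ### The spectrum of a bipartite distance-regular graph -/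

/-- Nonzero vectors that are separated by a family of endomorphisms are linearly independent. -/
theorem linearIndependent_of_separated {ι V : Type*} [DecidableEq ι] [AddCommGroup V] [Module ℂ V]
    (P : ι → V →ₗ[ℂ] V) (w : ι → V) (hP : ∀ i j, P i (w j) = if i = j then w i else 0)
    (hw : ∀ i, w i ≠ 0) : LinearIndependent ℂ w := by
  rw [linearIndependent_iff']
  intro s g hg i hi
  have := congrArg (P i) hg
  simp only [map_sum, map_smul, hP, map_zero, smul_ite, smul_zero, Finset.sum_ite_eq, hi,
    if_true] at this
  exact (smul_eq_zero.1 this).resolve_right (hw i)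

theorem mem_eigSet_iff {t : ℝ} :
    t ∈ eigSet Γ ↔ Module.End.HasEigenvalue (Matrix.toLin' (adjM Γ)) (t : ℂ) := by
  rw [Module.End.hasEigenvalue_iff_mem_spectrum, Matrix.spectrum_toLin', eigSet,
    Set.Finite.mem_toFinset]
  exact (spectrum.algebraMap_mem_iff ℂ).symm

theorem exists_theta_eq {t : ℝ} (ht : t ∈ eigSet Γ) : ∃ i < (eigSet Γ).card, theta Γ i = t := by
  obtain ⟨i, hi, h⟩ := List.mem_iff_getElem.1 ((Finset.mem_sort (s := eigSet Γ) (· ≥ ·)).2 ht)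
  exact ⟨i, by simpa using hi, by rw [theta, List.getD_eq_getElem _ _ hi, h]⟩

/-- By spectral mapping, the value 1 of the Lagrange polynomial at θ_i lies in the spectrum of E_i,
whereas the zero matrix has spectrum {0}. -/
theorem primIdem_ne_zero (hconn : Γ.Connected) {i : ℕ} (hi : i < (eigSet Γ).card) :
    primIdem Γ i ≠ 0 := by
  intro h
  have := hconn.nonempty
  have hmem : theta Γ i ∈ spectrum ℝ (adjM Γ) := by
    have := theta_mem Γ hi
    rwa [eigSet, Set.Finite.mem_toFinset] at this
  have h1 := spectrum.subset_polynomial_aeval (adjM Γ)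
    (Lagrange.basis (eigSet Γ) id (theta Γ i)) ⟨_, hmem, rfl⟩
  have hself := Lagrange.eval_basis_self (F := ℝ) (v := id) (s := eigSet Γ)
    (Set.injOn_id _) (theta_mem Γ hi)
  simp only [id] at hself
  rw [← primIdem, h, spectrum.zero_eq] at h1
  exact one_ne_zero (hself.symm.trans h1)

theorem adjM_eq_adjMatrix [DecidableRel Γ.Adj] : adjM Γ = Γ.adjMatrix ℂ := by
  ext y z
  rw [adjM_apply, SimpleGraph.adjMatrix_apply]

theorem adjM_pow_apply_of_lt {y z : X} {m : ℕ} (h : m < Γ.dist y z) : (adjM Γ ^ m) y z = 0 := by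
  classical
  rw [adjM_eq_adjMatrix, SimpleGraph.adjMatrix_pow_apply_eq_card_walk, Nat.cast_eq_zero,
    Fintype.card_eq_zero_iff]
  refine ⟨fun w => ?_⟩
  have h1 := SimpleGraph.dist_le w.1
  have h2 : w.1.length = m := w.2
  omega

theorem adjM_pow_apply_dist_ne_zero (hconn : Γ.Connected) (y z : X) :
    (adjM Γ ^ Γ.dist y z) y z ≠ 0 := by
  classical
  rw [adjM_eq_adjMatrix, SimpleGraph.adjMatrix_pow_apply_eq_card_walk, Nat.cast_ne_zero,
    ← Nat.pos_iff_ne_zero, Fintype.card_pos_iff]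
  obtain ⟨w, hw⟩ := hconn.exists_walk_length_eq_dist y z
  exact ⟨⟨w, hw⟩⟩

/-- If there were m ≤ D eigenvalues, a monic polynomial of degree m would annihilate A; but at a
pair of vertices at distance m only the leading power A^m has a nonzero entry. -/
theorem diam_lt_card_eigSet (hconn : Γ.Connected) : Γ.diam < (eigSet Γ).card := by
  by_contra! hle
  obtain ⟨y, z, hz, -⟩ := exists_geodesic hconn
  set m := (eigSet Γ).card with hm
  let P : Polynomial ℝ := ∏ t ∈ eigSet Γ, (Polynomial.X - Polynomial.C t)
  have hP : P.Monic := Polynomial.monic_prod_of_monic _ _ fun t _ => Polynomial.monic_X_sub_C t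
  have hdeg : P.natDegree = m := by
    rw [Polynomial.natDegree_prod_of_monic _ _ fun t _ => Polynomial.monic_X_sub_C t]
    simp [hm]
  have h0 : Polynomial.aeval (adjM Γ) P = 0 := by
    rw [aeval_adjM_congr Γ (q := P) (r := 0), map_zero]
    intro t ht
    rw [Polynomial.eval_prod, Polynomial.eval_zero]
    exact Finset.prod_eq_zero ht (by simp)
  have h1 := congrFun (congrFun h0 y) (z m)
  rw [Polynomial.aeval_eq_sum_range, hdeg, Matrix.sum_apply, Finset.sum_range_succ,
    Finset.sum_eq_zero] at h1
  · have hlead : P.coeff m = 1 := by rw [← hdeg]; exact hP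
    rw [hlead, one_smul, zero_add] at h1
    have h2 := adjM_pow_apply_dist_ne_zero hconn y (z m)
    rw [hz m hle] at h2
    exact h2 h1
  · intro i hi
    rw [Matrix.smul_apply, adjM_pow_apply_of_lt, smul_zero]
    rw [hz m hle]
    exact Finset.mem_range.1 hi

/-- Reading entries along a maximal geodesic embeds M into a space of dimension D + 1, and the
primitive idempotents are linearly independent in M. -/
theorem card_eigSet_le (hΓ : IsDistanceRegularWith Γ p) :
    (eigSet Γ).card ≤ Γ.diam + 1 := by
  obtain ⟨y, z, hz, -⟩ := exists_geodesic hΓ.connected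
  let φ : boseMesner Γ →ₗ[ℂ] (Fin (Γ.diam + 1) → ℂ) :=
    { toFun := fun B j => B.1 y (z j)
      map_add' := fun _ _ => rfl
      map_smul' := fun _ _ => rfl }
  have hφ : Function.Injective φ := by
    rw [injective_iff_map_eq_zero]
    rintro ⟨B, hB⟩ h
    obtain ⟨s, hs⟩ := exists_eq_of_mem_boseMesner hΓ hB
    refine Subtype.ext ?_
    ext u v
    have hle := dist_le_diam_of_connected hΓ.connected u v
    have h1 : B y (z (Γ.dist u v)) = 0 := congrFun h ⟨Γ.dist u v, by omega⟩
    rw [hs, hz _ hle] at h1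
    exact (hs u v).trans h1
  have hli : LinearIndependent ℂ (fun i : Fin (eigSet Γ).card =>
      (⟨primIdem Γ i, primIdem_mem_boseMesner i⟩ : boseMesner Γ)) := by
    refine LinearIndependent.of_comp (boseMesner Γ).val.toLinearMap ?_
    refine linearIndependent_of_separated 
      (fun i : Fin (eigSet Γ).card => LinearMap.mulLeft ℂ (primIdem Γ i)) _ ?_
      fun i => primIdem_ne_zero hΓ.connected i.2
    intro i j
    have := primIdem_mul_primIdem Γ i.2 j.2
    simpa [Fin.ext_iff] using this
  have h1 := hli.fintype_card_le_finrank
  have h2 := LinearMap.finrank_le_finrank_of_injective hφ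
  simp only [Fintype.card_fin, Module.finrank_fin_fun] at h1 h2
  exact h1.trans h2

theorem card_eigSet (hΓ : IsDistanceRegularWith Γ p) : (eigSet Γ).card = Γ.diam + 1 :=
  le_antisymm (card_eigSet_le hΓ) (diam_lt_card_eigSet hΓ.connected)

/-- Conjugating A by the diagonal ±1 matrix of the two-colouring turns it into -A. -/
theorem neg_mem_eigSet (hbip : Γ.IsBipartite) {t : ℝ} (ht : t ∈ eigSet Γ) : -t ∈ eigSet Γ := by
  obtain ⟨c⟩ := exists_boolColoring hbip
  let S : Matrix X X ℂ := Matrix.diagonal fun y => if c y then 1 else -1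
  have hS : S * S = 1 := by
    rw [Matrix.diagonal_mul_diagonal, ← Matrix.diagonal_one]
    congr 1
    ext y
    split_ifs <;> simp
  let U : (Matrix X X ℂ)ˣ := ⟨S, S, hS, hS⟩
  have hU : (U : Matrix X X ℂ) * adjM Γ * (U⁻¹ : (Matrix X X ℂ)ˣ) = -adjM Γ := by
    change S * adjM Γ * S = _
    ext y z
    rw [Matrix.mul_diagonal, Matrix.diagonal_mul, Matrix.neg_apply]
    classical
    rw [adjM_apply]
    by_cases h : Γ.Adj y z
    · have := c.valid h
      cases hy : c y <;> cases hz : c z <;> simp_all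
    · simp [h]
  rw [eigSet, Set.Finite.mem_toFinset] at ht ⊢
  rw [← spectrum.units_conjugate (u := U), hU, ← spectrum.neg_eq] at ht
  exact ht

/-- Both sides enumerate the same finite set increasingly, and such an enumeration is unique. -/
theorem theta_diam_sub (hΓ : IsDistanceRegularWith Γ p) (hbip : Γ.IsBipartite) {i : ℕ}
    (hi : i ≤ Γ.diam) : theta Γ (Γ.diam - i) = -theta Γ i := by
  have hcard := card_eigSet hΓ
  have h1 := Finset.orderEmbOfFin_unique hcard
    (f := fun i : Fin (Γ.diam + 1) => theta Γ (Γ.diam - i))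
    (fun i => theta_mem Γ (by omega))
    (fun i j hij => theta_strictAnti Γ (by have : (i : ℕ) < j := hij; omega) (by omega))
  have h2 := Finset.orderEmbOfFin_unique hcard
    (f := fun i : Fin (Γ.diam + 1) => -theta Γ i)
    (fun i => neg_mem_eigSet hbip (theta_mem Γ (by omega)))
    (fun i j hij => neg_lt_neg (theta_strictAnti Γ hij (by omega)))
  exact congrFun (h1.trans h2.symm) ⟨i, by omega⟩

theorem theta_middle (hΓ : IsDistanceRegularWith Γ p) (hbip : Γ.IsBipartite) {d : ℕ}
    (hd : Γ.diam = 2 * d) : theta Γ d = 0 := by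
  have := theta_diam_sub hΓ hbip (i := d) (by omega)
  rw [show Γ.diam - d = d by omega] at this
  linarith

theorem theta_zero (hΓ : IsDistanceRegularWith Γ p) (hbip : Γ.IsBipartite)
    (hD : 1 ≤ Γ.diam) : theta Γ 0 = bNum Γ p 0 := by
  have hcard := card_eigSet hΓ
  have := hΓ.connected.nonempty
  apply le_antisymm
  -- Gershgorin: zero diagonal and row sums k bound every eigenvalue by k. The all-ones vector gives
  -- the reverse inequality.
  · obtain ⟨y, hy⟩ := eigenvalue_mem_ball (mem_eigSet_iff.1 (theta_mem Γ (i := 0) (by omega)))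
    have h0 : adjM Γ y y = 0 := by simp [adjM, distMatrix]
    have hsum : ∑ z ∈ Finset.univ.erase y, ‖adjM Γ y z‖ = bNum Γ p 0 := by
      have h1 := sum_adjM hΓ hbip hD y
      rw [Finset.sum_erase _ (by rw [h0, norm_zero])]
      have h2 : ∀ z, adjM Γ y z = (‖adjM Γ y z‖ : ℂ) := by
        intro z
        simp only [adjM, distMatrix, Matrix.of_apply]
        split_ifs <;> simp
      rw [Finset.sum_congr rfl fun z _ => h2 z] at h1
      exact_mod_cast h1
    rw [h0, hsum, mem_closedBall_zero_iff, Complex.norm_real] at hy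
    exact (le_abs_self _).trans hy
  · have hmem : (bNum Γ p 0 : ℝ) ∈ eigSet Γ := by
      rw [mem_eigSet_iff]
      refine Module.End.hasEigenvalue_of_hasEigenvector (x := fun _ => 1) ⟨?_, ?_⟩
      · rw [Module.End.mem_eigenspace_iff]
        ext y
        simpa [Matrix.mulVec, dotProduct] using sum_adjM hΓ hbip hD y
      · intro h
        exact one_ne_zero (congrFun h this.some)
    obtain ⟨i, hi, h⟩ := exists_theta_eq hmem
    rw [← h]
    rcases Nat.eq_zero_or_pos i with rfl | hi0
    · exact le_rfl
    · exact (theta_strictAnti Γ hi0 hi).le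

/-! ### Primitive idempotents acting on the second subconstituent -/

theorem primIdem_mul_of_mem_boseMesner (i : ℕ) {B : Matrix X X ℂ} (hB : B ∈ boseMesner Γ) :
    ∃ c : ℂ, primIdem Γ i * B = c • primIdem Γ i := by
  induction hB using Algebra.adjoin_induction with
  | mem B hB =>
    obtain rfl := hB
    refine ⟨theta Γ i, ?_⟩
    have hcomm : primIdem Γ i * adjM Γ = adjM Γ * primIdem Γ i := by
      have h := congrArg (Polynomial.aeval (adjM Γ))
        (mul_comm (Lagrange.basis (eigSet Γ) id (theta Γ i)) Polynomial.X)
      rwa [map_mul, map_mul, Polynomial.aeval_X] at h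
    rw [hcomm, adjM_mul_primIdem]
    ext y z
    simp
  | algebraMap r => exact ⟨r, by rw [← Algebra.commutes, ← Algebra.smul_def]⟩
  | add B C _ _ hB hC =>
    obtain ⟨b, hb⟩ := hB
    obtain ⟨c, hc⟩ := hC
    exact ⟨b + c, by rw [mul_add, hb, hc, add_smul]⟩
  | mul B C _ _ hB hC =>
    obtain ⟨b, hb⟩ := hB
    obtain ⟨c, hc⟩ := hC
    exact ⟨b * c, by rw [← mul_assoc, hb, smul_mul_assoc, hc, smul_smul]⟩

theorem primIdem_conjTranspose (i : ℕ) : (primIdem Γ i)ᴴ = primIdem Γ i := by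
  have h : IsSelfAdjoint (primIdem Γ i) := by
    rw [primIdem, ← cfc_polynomial _ (adjM Γ) (adjM_isSelfAdjoint Γ)]
    exact cfc_predicate _ _
  exact h

theorem dualIdem_mulVec_apply (x : X) (i : ℕ) (w : X → ℂ) (y : X) :
    (dualIdem Γ x i *ᵥ w) y = if Γ.dist x y = i then w y else 0 := by
  rw [dualIdem, Matrix.mulVec_diagonal, ite_mul, one_mul, zero_mul]

/-- The values on the second subconstituent of `B v`, where `B` is a function of the distance and
`v` is an eigenvector of the second local graph that is supported there and has sum zero. -/
theorem mulVec_apply_of_localEigenvector (hconn : Γ.Connected) (hbip : Γ.IsBipartite) {x : X}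
    {v : X → ℂ} (hv : dualIdem Γ x 2 *ᵥ v = v) (hsum : ∑ z, v z = 0) {η : ℂ}
    (hη : (dualIdem Γ x 2 * distMatrix Γ 2 * dualIdem Γ x 2) *ᵥ v = η • v)
    {B : Matrix X X ℂ} {s : ℕ → ℂ} (hs : ∀ y z, B y z = s (Γ.dist y z)) {y : X}
    (hy : Γ.dist x y = 2) :
    (B *ᵥ v) y = (s 0 + η * s 2 - (1 + η) * s 4) * v y := by
  have hη' : ∑ z, (if Γ.dist y z = 2 then v z else 0) = η * v y := by
    have h := congrFun hη y
    rw [← Matrix.mulVec_mulVec, hv, ← Matrix.mulVec_mulVec, dualIdem_mulVec_apply, if_pos hy] at h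
    simpa [Matrix.mulVec, dotProduct, distMatrix] using h
  -- Only distances 0, 2, 4 occur on the support of v. Taking the value at distance 4 as baseline,
  -- its sum against v vanishes and only the corrections at distances 0 and 2 are left.
  have hterm : ∀ z, B y z * v z = s 4 * v z + (s 0 - s 4) * (if y = z then v z else 0) +
      (s 2 - s 4) * (if Γ.dist y z = 2 then v z else 0) := by
    intro z
    by_cases hz : Γ.dist x z = 2
    · have h1 := (even_dist_add_dist_iff hconn hbip x y z).1 (by rw [hy, hz]; decide)
      have h2 : Γ.dist y z ≤ Γ.dist y x + Γ.dist x z := hconn.dist_triangle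
      rw [Γ.dist_comm (u := y) (v := x), hy, hz] at h2
      have h3 : Γ.dist y z = 0 ∨ Γ.dist y z = 2 ∨ Γ.dist y z = 4 := by
        obtain ⟨m, hm⟩ := h1
        omega
      rw [hs]
      have h4 := hconn.dist_eq_zero_iff (u := y) (v := z)
      rcases h3 with h3 | h3 | h3
      · rw [if_pos (h4.1 h3), h3]; norm_num; ring
      · rw [if_neg (fun h => by have := h4.2 h; omega), h3]; norm_num; ring
      · rw [if_neg (fun h => by have := h4.2 h; omega), h3]; norm_num
    · have h0 : v z = 0 := by rw [← hv, dualIdem_mulVec_apply, if_neg hz]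
      simp [h0]
  have h : (B *ᵥ v) y = ∑ z, B y z * v z := rfl
  rw [h, Finset.sum_congr rfl fun z _ => hterm z, Finset.sum_add_distrib, Finset.sum_add_distrib,
    ← Finset.mul_sum, ← Finset.mul_sum, ← Finset.mul_sum, hsum, hη', Finset.sum_ite_eq,
    if_pos (Finset.mem_univ y)]
  ring

open scoped ComplexOrder in
/-- For the local eigenvalue `b_3 - 1`, the idempotent `E_i` annihilates `v` exactly when
`θ_i ∈ {0, k, -k}`. -/
theorem primIdem_mulVec_eq_zero_iff (hΓ : IsDistanceRegularWith Γ p) (hbip : Γ.IsBipartite)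
    (hD : 4 ≤ Γ.diam) {x : X} {v : X → ℂ} (hv0 : v ≠ 0) (hv : dualIdem Γ x 2 *ᵥ v = v)
    (hsum : ∑ z, v z = 0)
    (hη : (dualIdem Γ x 2 * distMatrix Γ 2 * dualIdem Γ x 2) *ᵥ v = ((bNum Γ p 3 : ℂ) - 1) • v)
    {i : ℕ} (hi : i ≤ Γ.diam) :
    primIdem Γ i *ᵥ v = 0 ↔ theta Γ i ^ 2 * ((bNum Γ p 0 : ℝ) ^ 2 - theta Γ i ^ 2) = 0 := by
  have hcard := card_eigSet hΓ
  obtain ⟨s, hs⟩ := exists_eq_of_mem_boseMesner hΓ (primIdem_mem_boseMesner (Γ := Γ) i)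
  have hE : adjM Γ * primIdem Γ i = (theta Γ i : ℂ) • primIdem Γ i := by
    rw [adjM_mul_primIdem]
    ext y z
    simp
  have hs0 : s 0 ≠ 0 := fun h => primIdem_ne_zero hΓ.connected (by omega)
    (eq_zero_of_value_zero hΓ hbip (by omega) hs hE h)
  set f : ℂ := s 0 + ((bNum Γ p 3 : ℂ) - 1) * s 2 - (1 + ((bNum Γ p 3 : ℂ) - 1)) * s 4 with hf
  have hval : ∀ y, Γ.dist x y = 2 → (primIdem Γ i *ᵥ v) y = f * v y := fun y hy =>
    mulVec_apply_of_localEigenvector hΓ.connected hbip hv hsum hη hs hy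
  have hsupp : ∀ y, Γ.dist x y ≠ 2 → v y = 0 := fun y hy => by
    rw [← hv, dualIdem_mulVec_apply, if_neg hy]
  have hiff : primIdem Γ i *ᵥ v = 0 ↔ f = 0 := by
    constructor
    · intro h
      obtain ⟨y, hy⟩ := Function.ne_iff.1 hv0
      have h1 := hval y (by by_contra h'; exact hy (hsupp y h'))
      rw [h] at h1
      exact (mul_eq_zero.1 h1.symm).resolve_right hy
    · intro h
      -- E_i is a Hermitian idempotent, so ‖E_i v‖² = ⟨v, E_i v⟩, which only sees E_i v on the
      -- support of v.
      rw [← dotProduct_star_self_eq_zero, Matrix.star_mulVec, primIdem_conjTranspose,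
        ← Matrix.dotProduct_mulVec, Matrix.mulVec_mulVec, primIdem_mul_primIdem Γ (by omega)
        (by omega), if_pos rfl]
      refine Finset.sum_eq_zero fun y _ => ?_
      by_cases hy : Γ.dist x y = 2
      · rw [hval y hy, h]; simp
      · simp [hsupp y hy]
  have r0 := three_term_recurrence hΓ hbip hs hE (j := 0) (by omega)
  have r1 := three_term_recurrence hΓ hbip hs hE (j := 1) (by omega)
  have r2 := three_term_recurrence hΓ hbip hs hE (j := 2) (by omega)
  have r3 := three_term_recurrence hΓ hbip hs hE (j := 3) (by omega)
  have k1 := cNum_add_bNum hΓ hbip (j := 1) (by omega)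
  have k2 := cNum_add_bNum hΓ hbip (j := 2) (by omega)
  have k3 := cNum_add_bNum hΓ hbip (j := 3) (by omega)
  have b0 : (bNum Γ p 0 : ℂ) ≠ 0 := Nat.cast_ne_zero.2 (bNum_pos hΓ (by omega)).ne'
  have b1 : (bNum Γ p 1 : ℂ) ≠ 0 := Nat.cast_ne_zero.2 (bNum_pos hΓ (by omega)).ne'
  have b2 : (bNum Γ p 2 : ℂ) ≠ 0 := Nat.cast_ne_zero.2 (bNum_pos hΓ (by omega)).ne'
  norm_num [p_zero_one_zero hΓ (by omega), p_one_one_zero hΓ (by omega)] at r0 r1 r2 r3 k1 k2 k3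
  have hkey : (bNum Γ p 0 : ℂ) * bNum Γ p 1 * bNum Γ p 2 * f =
      (theta Γ i : ℂ) ^ 2 * ((bNum Γ p 0 : ℂ) ^ 2 - (theta Γ i : ℂ) ^ 2) * s 0 := by
    -- This is where b_3 - 1 matters: c_3 + b_3 = 1 + b_1 turns f into the difference of the
    -- recurrences at j = 1 and j = 3.
    have h1 : f = (theta Γ i : ℂ) * (s 1 - s 3) := by
      rw [hf]
      linear_combination r1 - r3 + s 2 * (k3 - k1)
    rw [h1]
    linear_combination (-(theta Γ i : ℂ) * bNum Γ p 0 * bNum Γ p 1) * r2 +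
      ((theta Γ i : ℂ) * bNum Γ p 0 * bNum Γ p 1 * s 1) * k2 +
      ((theta Γ i : ℂ) * bNum Γ p 0 * bNum Γ p 1 - (theta Γ i : ℂ) ^ 3) * r0 -
      ((theta Γ i : ℂ) ^ 2 * bNum Γ p 0) * r1 + ((theta Γ i : ℂ) ^ 2 * bNum Γ p 0 * s 0) * k1
  rw [hiff]
  constructor
  · intro h
    rw [h, mul_zero] at hkey
    have := (mul_eq_zero.1 hkey.symm).resolve_right hs0
    exact_mod_cast this
  · intro h
    have h' : (theta Γ i : ℂ) ^ 2 * ((bNum Γ p 0 : ℂ) ^ 2 - (theta Γ i : ℂ) ^ 2) = 0 := by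
      exact_mod_cast h
    rw [h', zero_mul] at hkey
    exact (mul_eq_zero.1 hkey).resolve_left (mul_ne_zero (mul_ne_zero b0 b1) b2)

/-! ### Thin irreducible modules of endpoint two -/

theorem dualIdem_mul_dualIdem_mulVec (x : X) (i j : ℕ) (w : X → ℂ) :
    dualIdem Γ x i *ᵥ (dualIdem Γ x j *ᵥ w) = if i = j then dualIdem Γ x j *ᵥ w else 0 := by
  ext y
  rw [dualIdem_mulVec_apply]
  split_ifs with h1 h2 h2
  · rfl
  · rw [dualIdem_mulVec_apply, if_neg (by omega)]; rfl
  · rw [dualIdem_mulVec_apply, if_neg (by omega)]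
  · rfl

theorem dualIdem_of_diam_lt (hconn : Γ.Connected) (x : X) {i : ℕ} (hi : Γ.diam < i) :
    dualIdem Γ x i = 0 := by
  rw [dualIdem, ← Matrix.diagonal_zero]
  congr 1
  ext y
  have := dist_le_diam_of_connected hconn x y
  rw [if_neg (by omega)]

theorem boseMesner_le (x : X) : boseMesner Γ ≤ subconstituentAlgebra Γ x := le_sup_left

theorem dualIdem_mem (hconn : Γ.Connected) (x : X) (i : ℕ) :
    dualIdem Γ x i ∈ subconstituentAlgebra Γ x := by
  rcases Nat.lt_or_ge Γ.diam i with h | h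
  · rw [dualIdem_of_diam_lt hconn x h]
    exact zero_mem _
  · exact (le_sup_right : dualBoseMesner Γ x ≤ _) (Algebra.subset_adjoin ⟨i, h, rfl⟩)

/-- A subspace is a `T`-module as soon as it is stable under the generators of `T`. -/
theorem isTModule_of_generators {x : X} {U : Submodule ℂ (X → ℂ)}
    (hA : ∀ w ∈ U, adjM Γ *ᵥ w ∈ U) (hE : ∀ i, ∀ w ∈ U, dualIdem Γ x i *ᵥ w ∈ U) :
    IsTModule Γ x U := by
  let S : Subalgebra ℂ (Matrix X X ℂ) :=
    { carrier := {B | ∀ w ∈ U, B *ᵥ w ∈ U}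
      mul_mem' := fun {B C} hB hC w hw => by
        rw [← Matrix.mulVec_mulVec]
        exact hB _ (hC _ hw)
      add_mem' := fun {B C} hB hC w hw => by
        rw [Matrix.add_mulVec]
        exact U.add_mem (hB _ hw) (hC _ hw)
      algebraMap_mem' := fun r w hw => by
        rw [Algebra.algebraMap_eq_smul_one, Matrix.smul_mulVec, Matrix.one_mulVec]
        exact U.smul_mem _ hw }
  have h : subconstituentAlgebra Γ x ≤ S := by
    refine sup_le (Algebra.adjoin_le ?_) (Algebra.adjoin_le ?_)
    · rintro _ rfl
      exact hA
    · rintro _ ⟨i, -, rfl⟩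
      exact hE i
  exact fun B hB => h hB

theorem mem_act_dualIdem_iff (hconn : Γ.Connected) {x : X} {W : Submodule ℂ (X → ℂ)}
    (hW : IsTModule Γ x W) {i : ℕ} {v : X → ℂ} :
    v ∈ act (dualIdem Γ x i) W ↔ v ∈ W ∧ dualIdem Γ x i *ᵥ v = v := by
  constructor
  · rintro ⟨w, hw, rfl⟩
    refine ⟨hW _ (dualIdem_mem hconn x i) w hw, ?_⟩
    rw [Matrix.mulVecLin_apply, dualIdem_mul_dualIdem_mulVec, if_pos rfl]
  · rintro ⟨hv, h⟩
    exact ⟨v, hv, h⟩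

theorem act_dualIdem_of_lt_endpoint {x : X} {W : Submodule ℂ (X → ℂ)} {i : ℕ}
    (hi : i < endpoint Γ x W) (hiD : i ≤ Γ.diam) : act (dualIdem Γ x i) W = ⊥ := by
  by_contra h
  exact Nat.notMem_of_lt_sInf hi ⟨hiD, h⟩

/-- The entry of A²v at x is c_2 times the sum of v, and it must vanish because A²v lies in W. -/
theorem sum_eq_zero_of_act_zero (hΓ : IsDistanceRegularWith Γ p) (hbip : Γ.IsBipartite)
    (hD : 3 ≤ Γ.diam) {x : X} {W : Submodule ℂ (X → ℂ)} (hW : IsTModule Γ x W)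
    (h0 : act (dualIdem Γ x 0) W = ⊥) {v : X → ℂ} (hv : v ∈ act (dualIdem Γ x 2) W) :
    ∑ z, v z = 0 := by
  obtain ⟨hvW, hv2⟩ := (mem_act_dualIdem_iff hΓ.connected hW).1 hv
  have hmem : (adjM Γ * adjM Γ) *ᵥ v ∈ W :=
    hW _ (boseMesner_le x (mul_mem adjM_mem_boseMesner adjM_mem_boseMesner)) v hvW
  have h1 : dualIdem Γ x 0 *ᵥ ((adjM Γ * adjM Γ) *ᵥ v) = 0 := by
    have : dualIdem Γ x 0 *ᵥ ((adjM Γ * adjM Γ) *ᵥ v) ∈ act (dualIdem Γ x 0) W := ⟨_, hmem, rfl⟩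
    rwa [h0, Submodule.mem_bot] at this
  have h2 := congrFun h1 x
  rw [dualIdem_mulVec_apply, if_pos (by simp)] at h2
  have h3 : ∀ z, (adjM Γ * adjM Γ) x z * v z = p 2 1 1 * v z := by
    intro z
    by_cases hz : Γ.dist x z = 2
    · have := sum_adjM_mul hΓ hbip (j := 2) (by omega) hz (fun j => if j = 1 then 1 else 0)
      norm_num at this
      rw [Matrix.mul_apply, ← this]
      congr 1
      refine Finset.sum_congr rfl fun w _ => ?_
      simp [adjM, distMatrix]
    · have h0 : v z = 0 := by rw [← hv2, dualIdem_mulVec_apply, if_neg hz]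
      simp [h0]
  have h4 : ∑ z, (adjM Γ * adjM Γ) x z * v z = 0 := h2
  rw [Finset.sum_congr rfl fun z _ => h3 z, ← Finset.mul_sum] at h4
  exact (mul_eq_zero.1 h4).resolve_left
    (Nat.cast_ne_zero.2 (cNum_pos hΓ (j := 1) (by omega)).ne')

/-- The vectors `R^j v`, where `R` is the raising matrix and `v` is supported at distance two
from `x`. -/
def raise (Γ : SimpleGraph X) (x : X) (v : X → ℂ) : ℕ → X → ℂ
  | 0 => v
  | j + 1 => dualIdem Γ x (j + 3) *ᵥ (adjM Γ *ᵥ raise Γ x v j)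

theorem raise_succ (x : X) (v : X → ℂ) (j : ℕ) :
    raise Γ x v (j + 1) = dualIdem Γ x (j + 3) *ᵥ (adjM Γ *ᵥ raise Γ x v j) := rfl

theorem raise_eq_zero_of_le {x : X} {v : X → ℂ} {j m : ℕ} (hjm : j ≤ m)
    (h : raise Γ x v j = 0) : raise Γ x v m = 0 := by
  induction m, hjm using Nat.le_induction with
  | base => exact h
  | succ m _ ih => rw [raise_succ, ih, Matrix.mulVec_zero, Matrix.mulVec_zero]

/-- For a vector supported at distance `i` from `x`, multiplication by `A` has a raising and
a lowering part. -/
theorem adjM_mulVec_eq_add (hconn : Γ.Connected) (hbip : Γ.IsBipartite) {x : X} {i : ℕ}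
    {u : X → ℂ} (hu : dualIdem Γ x (i + 1) *ᵥ u = u) :
    adjM Γ *ᵥ u = dualIdem Γ x (i + 2) *ᵥ (adjM Γ *ᵥ u) + dualIdem Γ x i *ᵥ (adjM Γ *ᵥ u) := by
  ext y
  rw [Pi.add_apply, dualIdem_mulVec_apply, dualIdem_mulVec_apply]
  by_cases h1 : Γ.dist x y = i + 2
  · rw [if_pos h1, if_neg (by omega), add_zero]
  by_cases h2 : Γ.dist x y = i
  · rw [if_neg h1, if_pos h2, zero_add]
  rw [if_neg h1, if_neg h2, add_zero]
  refine Finset.sum_eq_zero fun z _ => ?_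
  beta_reduce
  by_cases hz : Γ.dist x z = i + 1
  · classical
    rw [adjM_apply, if_neg, zero_mul]
    intro h
    have := dist_of_adj hconn hbip x h
    omega
  · rw [← hu, dualIdem_mulVec_apply, if_neg hz, mul_zero]

theorem exists_smul_eq_of_finrank_le_one {V : Type*} [AddCommGroup V] [Module ℂ V]
    [FiniteDimensional ℂ V] {S : Submodule ℂ V} (hS : Module.finrank ℂ S ≤ 1) {u w : V}
    (hu : u ∈ S) (hw : w ∈ S) (hu0 : u ≠ 0) : ∃ c : ℂ, w = c • u := by
  obtain ⟨e, he⟩ := finrank_le_one_iff.1 hS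
  obtain ⟨a, ha⟩ := he ⟨u, hu⟩
  obtain ⟨b, hb⟩ := he ⟨w, hw⟩
  have ha' : a • (e : V) = u := congrArg Subtype.val ha
  have hb' : b • (e : V) = w := congrArg Subtype.val hb
  have ha0 : a ≠ 0 := by
    rintro rfl
    exact hu0 (by rw [← ha', zero_smul])
  exact ⟨b * a⁻¹, by rw [← ha', ← hb', smul_smul, inv_mul_cancel_right₀ ha0]⟩

section EndpointTwo

variable {x : X} {W : Submodule ℂ (X → ℂ)} {v : X → ℂ}

theorem raise_mem (hconn : Γ.Connected) (hW : IsTModule Γ x W)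
    (hv : v ∈ act (dualIdem Γ x 2) W) (j : ℕ) :
    raise Γ x v j ∈ act (dualIdem Γ x (j + 2)) W := by
  induction j with
  | zero => exact hv
  | succ j ih =>
    exact ⟨_, hW _ (boseMesner_le x adjM_mem_boseMesner) _
      ((mem_act_dualIdem_iff hconn hW).1 ih).1, rfl⟩

theorem dualIdem_mulVec_raise (hconn : Γ.Connected) (hW : IsTModule Γ x W)
    (hv : v ∈ act (dualIdem Γ x 2) W) (i j : ℕ) :
    dualIdem Γ x i *ᵥ raise Γ x v j = if i = j + 2 then raise Γ x v j else 0 := by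
  have h := ((mem_act_dualIdem_iff hconn hW).1 (raise_mem hconn hW hv j)).2
  rw [← h, dualIdem_mul_dualIdem_mulVec, h]

/-- The three-term relation `A R^j v = R^{j+1} v + c R^{j-1} v`. -/
theorem adjM_mulVec_raise (hconn : Γ.Connected) (hbip : Γ.IsBipartite) (hW : IsTModule Γ x W)
    (hthin : IsThin Γ x W) (hv : v ∈ act (dualIdem Γ x 2) W)
    (h1 : act (dualIdem Γ x 1) W = ⊥) (j : ℕ) :
    ∃ c : ℂ, adjM Γ *ᵥ raise Γ x v j = raise Γ x v (j + 1) + c • raise Γ x v (j - 1) := by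
  have hmem := raise_mem hconn hW hv
  have hA : ∀ j i, dualIdem Γ x i *ᵥ (adjM Γ *ᵥ raise Γ x v j) ∈ act (dualIdem Γ x i) W :=
    fun j i => ⟨_, hW _ (boseMesner_le x adjM_mem_boseMesner) _
      ((mem_act_dualIdem_iff hconn hW).1 (hmem j)).1, rfl⟩
  have hsplit := adjM_mulVec_eq_add hconn hbip (i := j + 1)
    ((mem_act_dualIdem_iff hconn hW).1 (hmem j)).2
  rw [← raise_succ] at hsplit
  rcases j with _ | j
  -- Here `j - 1` truncates to 0, so the coefficient has to be 0; the lowering part indeed lies in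
  -- E_1^*W = 0.
  · refine ⟨0, ?_⟩
    have h := hA 0 1
    rw [h1, Submodule.mem_bot] at h
    rw [hsplit, h, add_zero, zero_smul, add_zero]
  · by_cases h0 : raise Γ x v j = 0
    · refine ⟨0, ?_⟩
      rw [raise_eq_zero_of_le (Nat.le_succ j) h0, raise_eq_zero_of_le (by omega) h0,
        Matrix.mulVec_zero, zero_smul, add_zero]
    -- Thinness is only available up to D; a nonzero raised vector cannot lie beyond it.
    · have hle : j + 2 ≤ Γ.diam := by
        by_contra! hlt
        have := dualIdem_mulVec_raise hconn hW hv (j + 2) j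
        rw [dualIdem_of_diam_lt hconn x hlt, Matrix.zero_mulVec, if_pos rfl] at this
        exact h0 this.symm
      obtain ⟨c, hc⟩ := exists_smul_eq_of_finrank_le_one (hthin _ hle) (hmem j)
        (hA (j + 1) (j + 2)) h0
      exact ⟨c, by rw [hsplit, hc]; rfl⟩

/-- The three-term relation makes the span stable under A, and each raised vector is homogeneous for
the E_i^*; irreducibility does the rest. -/
theorem span_raise (hconn : Γ.Connected) (hbip : Γ.IsBipartite)
    (hirr : IsIrreducibleTModule Γ x W) (hthin : IsThin Γ x W)
    (hv : v ∈ act (dualIdem Γ x 2) W) (hv0 : v ≠ 0) (h1 : act (dualIdem Γ x 1) W = ⊥) :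
    Submodule.span ℂ (Set.range (raise Γ x v)) = W := by
  have hW := hirr.isTModule
  have hmem : ∀ j, raise Γ x v j ∈ Submodule.span ℂ (Set.range (raise Γ x v)) :=
    fun j => Submodule.subset_span ⟨j, rfl⟩
  have hstable : ∀ B : Matrix X X ℂ,
      (∀ j, B *ᵥ raise Γ x v j ∈ Submodule.span ℂ (Set.range (raise Γ x v))) →
      ∀ w ∈ Submodule.span ℂ (Set.range (raise Γ x v)),
        B *ᵥ w ∈ Submodule.span ℂ (Set.range (raise Γ x v)) := by
    intro B hB w hw
    have : Submodule.span ℂ (Set.range (raise Γ x v)) ≤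
        (Submodule.span ℂ (Set.range (raise Γ x v))).comap B.mulVecLin := by
      rw [Submodule.span_le]
      rintro _ ⟨j, rfl⟩
      exact hB j
    exact this hw
  refine (hirr.eq_bot_or_eq _ ?_ (isTModule_of_generators ?_ ?_)).resolve_left ?_
  · rw [Submodule.span_le]
    rintro _ ⟨j, rfl⟩
    exact ((mem_act_dualIdem_iff hconn hW).1 (raise_mem hconn hW hv j)).1
  · refine hstable _ fun j => ?_
    obtain ⟨c, hc⟩ := adjM_mulVec_raise hconn hbip hW hthin hv h1 j
    rw [hc]
    exact add_mem (hmem _) (Submodule.smul_mem _ _ (hmem _))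
  · refine fun i => hstable _ fun j => ?_
    rw [dualIdem_mulVec_raise hconn hW hv]
    split_ifs
    · exact hmem j
    · exact zero_mem _
  · intro h
    have := hmem 0
    rw [h, Submodule.mem_bot] at this
    exact hv0 this

/-- A thin irreducible `T`-module of endpoint two is generated by `E_2^* W` over `M`. -/
theorem exists_boseMesner_mulVec_eq (hconn : Γ.Connected) (hbip : Γ.IsBipartite)
    (hirr : IsIrreducibleTModule Γ x W) (hthin : IsThin Γ x W)
    (hv : v ∈ act (dualIdem Γ x 2) W) (hv0 : v ≠ 0) (h1 : act (dualIdem Γ x 1) W = ⊥)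
    {w : X → ℂ} (hw : w ∈ W) : ∃ B ∈ boseMesner Γ, B *ᵥ v = w := by
  -- The relation R^{j+1}v = A R^j v - c R^{j-1}v needs two consecutive terms in the induction.
  have hr : ∀ j, (∃ B ∈ boseMesner Γ, B *ᵥ v = raise Γ x v j) ∧
      ∃ B ∈ boseMesner Γ, B *ᵥ v = raise Γ x v (j - 1) := by
    intro j
    induction j with
    | zero =>
      have : ∃ B ∈ boseMesner Γ, B *ᵥ v = raise Γ x v 0 := ⟨1, one_mem _, Matrix.one_mulVec v⟩
      exact ⟨this, this⟩
    | succ j ih =>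
      obtain ⟨⟨B, hB, hBv⟩, ⟨C, hC, hCv⟩⟩ := ih
      obtain ⟨c, hc⟩ := adjM_mulVec_raise hconn hbip hirr.isTModule hthin hv h1 j
      refine ⟨⟨adjM Γ * B - c • C,
        sub_mem (mul_mem adjM_mem_boseMesner hB) (Subalgebra.smul_mem _ hC c), ?_⟩, B, hB, hBv⟩
      rw [Matrix.sub_mulVec, ← Matrix.mulVec_mulVec, Matrix.smul_mulVec, hBv, hCv, hc,
        add_sub_cancel_right]
  rw [← span_raise hconn hbip hirr hthin hv hv0 h1] at hw
  induction hw using Submodule.span_induction with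
  | mem w hw =>
    obtain ⟨j, rfl⟩ := hw
    exact (hr j).1
  | zero => exact ⟨0, zero_mem _, Matrix.zero_mulVec v⟩
  | add w w' _ _ h h' =>
    obtain ⟨B, hB, rfl⟩ := h
    obtain ⟨C, hC, rfl⟩ := h'
    exact ⟨B + C, add_mem hB hC, Matrix.add_mulVec _ _ _⟩
  | smul a w _ h =>
    obtain ⟨B, hB, rfl⟩ := h
    exact ⟨a • B, Subalgebra.smul_mem _ hB a, Matrix.smul_mulVec _ _ _⟩

theorem linearIndependent_raise (hconn : Γ.Connected) (hW : IsTModule Γ x W)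
    (hv : v ∈ act (dualIdem Γ x 2) W) {n : ℕ} (hn : ∀ j < n, raise Γ x v j ≠ 0) :
    LinearIndependent ℂ (fun j : Fin n => raise Γ x v j) := by
  refine linearIndependent_of_separated (fun j : Fin n => (dualIdem Γ x (j + 2)).mulVecLin) _ ?_
    fun j => hn j j.2
  intro i j
  rw [Matrix.mulVecLin_apply, dualIdem_mulVec_raise hconn hW hv]
  by_cases h : i = j
  · subst h; simp
  · have : (i : ℕ) ≠ j := fun h' => h (Fin.ext h')
    rw [if_neg (by omega), if_neg h]

/-- Once a raised vector vanishes, so do all later ones; the nonzero ones have disjoint supports and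
span W, so they are exactly the first dim W. -/
theorem raise_ne_zero_iff (hconn : Γ.Connected) (hbip : Γ.IsBipartite)
    (hirr : IsIrreducibleTModule Γ x W) (hthin : IsThin Γ x W)
    (hv : v ∈ act (dualIdem Γ x 2) W) (hv0 : v ≠ 0) (h1 : act (dualIdem Γ x 1) W = ⊥) (j : ℕ) :
    raise Γ x v j ≠ 0 ↔ j < Module.finrank ℂ W := by
  have hW := hirr.isTModule
  have hspan := span_raise hconn hbip hirr hthin hv hv0 h1
  constructor
  · intro h
    have hli := linearIndependent_raise hconn hW hv (n := j + 1) fun i hi h' =>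
      h (raise_eq_zero_of_le (by omega) h')
    have hfin := finrank_span_eq_card hli
    rw [Fintype.card_fin] at hfin
    have hle : Submodule.span ℂ (Set.range fun i : Fin (j + 1) => raise Γ x v i) ≤ W := by
      rw [Submodule.span_le]
      rintro _ ⟨i, rfl⟩
      exact ((mem_act_dualIdem_iff hconn hW).1 (raise_mem hconn hW hv i)).1
    have := Submodule.finrank_mono hle
    omega
  · intro h h0
    have hle : W ≤ Submodule.span ℂ (Set.range fun i : Fin j => raise Γ x v i) := by
      rw [← hspan, Submodule.span_le]
      rintro _ ⟨i, rfl⟩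
      rcases Nat.lt_or_ge i j with hi | hi
      · exact Submodule.subset_span ⟨⟨i, hi⟩, rfl⟩
      · rw [raise_eq_zero_of_le hi h0]
        exact zero_mem _
    have h2 := Submodule.finrank_mono hle
    have h3 := finrank_range_le_card (R := ℂ) (fun i : Fin j => raise Γ x v i)
    rw [Fintype.card_fin] at h3
    have h4 : Module.finrank ℂ W ≤ j := h2.trans h3
    omega

theorem act_dualIdem_eq_span_raise (hconn : Γ.Connected) (hbip : Γ.IsBipartite)
    (hirr : IsIrreducibleTModule Γ x W) (hthin : IsThin Γ x W)
    (hv : v ∈ act (dualIdem Γ x 2) W) (hv0 : v ≠ 0) (h1 : act (dualIdem Γ x 1) W = ⊥) (j : ℕ) :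
    act (dualIdem Γ x (j + 2)) W = Submodule.span ℂ {raise Γ x v j} := by
  have hW := hirr.isTModule
  apply le_antisymm
  · rw [act, ← span_raise hconn hbip hirr hthin hv hv0 h1, Submodule.map_span_le]
    rintro _ ⟨i, rfl⟩
    rw [Matrix.mulVecLin_apply, dualIdem_mulVec_raise hconn hW hv]
    split_ifs with h
    · obtain rfl : j = i := by omega
      exact Submodule.mem_span_singleton_self _
    · exact zero_mem _
  · rw [Submodule.span_singleton_le_iff_mem]
    exact raise_mem hconn hW hv j

end EndpointTwo

/-! ### The distinguished eigenvalues and the basis of vectors E_i v -/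

theorem tilde_zero (hb : bNum Γ p 2 ≠ 0) :
    tilde Γ p ((0 : ℂ) : OnePoint ℂ) = ((bNum Γ p 3 - 1 : ℂ) : OnePoint ℂ) := by
  have hb' : (bNum Γ p 2 : ℂ) ≠ 0 := Nat.cast_ne_zero.2 hb
  change (if (0 : ℂ) ^ 2 = (bNum Γ p 2 : ℂ) then ∞ else _) = _
  rw [if_neg (by simpa using hb'.symm)]
  congr 1
  rw [zero_pow two_ne_zero, zero_sub, div_neg, mul_div_cancel_left₀ _ hb']
  ring

theorem theta_inj (hΓ : IsDistanceRegularWith Γ p) {i j : ℕ} (hi : i ≤ Γ.diam)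
    (hj : j ≤ Γ.diam) (h : theta Γ i = theta Γ j) : i = j := by
  have hcard := card_eigSet hΓ
  rcases lt_trichotomy i j with hij | hij | hij
  · exact absurd h (theta_strictAnti Γ hij (by omega)).ne'
  · exact hij
  · exact absurd h (theta_strictAnti Γ hij (by omega)).ne

theorem theta_polynomial_eq_zero_iff (hΓ : IsDistanceRegularWith Γ p) (hbip : Γ.IsBipartite)
    (hD : 1 ≤ Γ.diam) {d : ℕ} (hd : Γ.diam = 2 * d) {i : ℕ} (hi : i ≤ Γ.diam) :
    theta Γ i ^ 2 * ((bNum Γ p 0 : ℝ) ^ 2 - theta Γ i ^ 2) = 0 ↔ i = 0 ∨ i = d ∨ i = Γ.diam := by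
  have h0 := theta_zero hΓ hbip hD
  have hm := theta_middle hΓ hbip hd
  have hl := theta_diam_sub hΓ hbip (i := 0) (by omega)
  rw [Nat.sub_zero] at hl
  constructor
  · intro h
    rcases mul_eq_zero.1 h with h | h
    · exact Or.inr (Or.inl (theta_inj hΓ hi (by omega)
        (by rw [hm, (pow_eq_zero_iff two_ne_zero).1 h])))
    · rcases sq_eq_sq_iff_eq_or_eq_neg.1 (sub_eq_zero.1 h).symm with h | h
      · exact Or.inl (theta_inj hΓ hi (by omega) (by rw [h0, h]))
      · exact Or.inr (Or.inr (theta_inj hΓ hi le_rfl (by rw [hl, h0, h])))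
  · rintro (rfl | rfl | rfl)
    · rw [h0]; ring
    · rw [hm]; ring
    · rw [hl, h0]; ring

/-- The nonzero vectors among the `E_i v` are linearly independent. -/
theorem linearIndependent_primIdem_mulVec (hΓ : IsDistanceRegularWith Γ p) {v : X → ℂ}
    {q : ℕ → Prop} (hq : ∀ i, q i → i ≤ Γ.diam) (hv : ∀ i, q i → primIdem Γ i *ᵥ v ≠ 0) :
    LinearIndependent ℂ (fun i : {i : ℕ // q i} => primIdem Γ i *ᵥ v) := by
  have hcard := card_eigSet hΓ
  refine linearIndependent_of_separated
    (fun i : {i : ℕ // q i} => (primIdem Γ i).mulVecLin) _ ?_ fun i => hv i i.2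
  intro i j
  have hi := hq i i.2
  have hj := hq j j.2
  rw [Matrix.mulVecLin_apply, Matrix.mulVec_mulVec,
    primIdem_mul_primIdem Γ (by omega) (by omega)]
  by_cases h : i = j
  · rw [if_pos h, if_pos (congrArg Subtype.val h)]
  · rw [if_neg h, if_neg (fun h' => h (Subtype.ext h')), Matrix.zero_mulVec]

/-- Decompose B as the sum of the E_i B, each a scalar multiple of E_i. -/
theorem mulVec_mem_span_primIdem (hΓ : IsDistanceRegularWith Γ p) {v : X → ℂ}
    {q : ℕ → Prop} (hv : ∀ i ≤ Γ.diam, ¬ q i → primIdem Γ i *ᵥ v = 0)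
    {B : Matrix X X ℂ} (hB : B ∈ boseMesner Γ) :
    B *ᵥ v ∈ Submodule.span ℂ (Set.range fun i : {i : ℕ // q i} => primIdem Γ i *ᵥ v) := by
  have hcard := card_eigSet hΓ
  rw [← one_mul B, ← sum_primIdem Γ, Finset.sum_mul, Matrix.sum_mulVec]
  refine Submodule.sum_mem _ fun i hi => ?_
  obtain ⟨c, hc⟩ := primIdem_mul_of_mem_boseMesner i hB
  rw [hc, Matrix.smul_mulVec]
  refine Submodule.smul_mem _ _ ?_
  by_cases h : q i
  · exact Submodule.subset_span ⟨⟨i, h⟩, rfl⟩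
  · rw [hv i (by rw [Finset.mem_range] at hi; omega) h]
    exact zero_mem _

theorem finrank_span_primIdem_mulVec {v : X → ℂ} {D d : ℕ} (hd : D = 2 * d) (hD : 4 ≤ D)
    (hli : LinearIndependent ℂ
      (fun i : {i : ℕ // 1 ≤ i ∧ i ≤ D - 1 ∧ i ≠ d} => primIdem Γ i *ᵥ v)) :
    Module.finrank ℂ (Submodule.span ℂ (Set.range
      (fun i : {i : ℕ // 1 ≤ i ∧ i ≤ D - 1 ∧ i ≠ d} => primIdem Γ i *ᵥ v))) = D - 2 := by
  have hmem : ∀ i, i ∈ (Finset.Icc 1 (D - 1)).erase d ↔ 1 ≤ i ∧ i ≤ D - 1 ∧ i ≠ d := by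
    intro i
    rw [Finset.mem_erase, Finset.mem_Icc]
    tauto
  let _ : Fintype {i : ℕ // 1 ≤ i ∧ i ≤ D - 1 ∧ i ≠ d} := Fintype.subtype _ hmem
  rw [finrank_span_eq_card hli, Fintype.card_of_subtype _ hmem,
    Finset.card_erase_of_mem (Finset.mem_Icc.2 (by omega)), Nat.card_Icc]
  omega

/-- The image of `M v` under `E_i` is spanned by `E_i v`. -/
theorem act_primIdem_eq_span {W : Submodule ℂ (X → ℂ)} {v : X → ℂ} (hv : v ∈ W)
    (hW : ∀ w ∈ W, ∃ B ∈ boseMesner Γ, B *ᵥ v = w) (i : ℕ) :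
    act (primIdem Γ i) W = Submodule.span ℂ {primIdem Γ i *ᵥ v} := by
  apply le_antisymm
  · rintro _ ⟨w, hw, rfl⟩
    obtain ⟨B, hB, rfl⟩ := hW w hw
    obtain ⟨c, hc⟩ := primIdem_mul_of_mem_boseMesner i hB
    rw [Matrix.mulVecLin_apply, Matrix.mulVec_mulVec, hc, Matrix.smul_mulVec]
    exact Submodule.smul_mem _ _ (Submodule.mem_span_singleton_self _)
  · rw [Submodule.span_singleton_le_iff_mem]
    exact ⟨v, hv, rfl⟩

end BipartiteDRG
end

open BipartiteDRG in
theorem theorem14p8 {X : Type*} [Fintype X] [DecidableEq X]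
    (Γ : SimpleGraph X) (p : ℕ → ℕ → ℕ → ℕ)
    (hΓ : IsDistanceRegularWith Γ p) (hbip : Γ.IsBipartite)
    (hD : 4 ≤ Γ.diam) (hk : 3 ≤ bNum Γ p 0)
    (d : ℕ) (hd : Γ.diam = 2 * d)
    (x : X) (W : Submodule ℂ (X → ℂ))
    (hirr : IsIrreducibleTModule Γ x W) (hthin : IsThin Γ x W)
    (hend : endpoint Γ x W = 2)
    (η : ℂ) (hη : HasLocalEigenvalue Γ x W η)
    (hηd : (η : OnePoint ℂ) = tilde Γ p ((theta Γ d : ℂ) : OnePoint ℂ)) :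
    Module.finrank ℂ W = Γ.diam - 2 ∧
    (∀ i ≤ Γ.diam,
      (i ∈ ({0, 1, Γ.diam} : Set ℕ) → act (dualIdem Γ x i) W = ⊥) ∧
      (2 ≤ i → i ≤ Γ.diam - 1 → Module.finrank ℂ (act (dualIdem Γ x i) W) = 1)) ∧
    (∀ i ≤ Γ.diam,
      (i ∈ ({0, d, Γ.diam} : Set ℕ) → act (primIdem Γ i) W = ⊥) ∧
      (1 ≤ i → i ≤ Γ.diam - 1 → i ≠ d → Module.finrank ℂ (act (primIdem Γ i) W) = 1)) ∧
    (∀ v ∈ act (dualIdem Γ x 2) W, v ≠ 0 →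
      (W : Set (X → ℂ)) = (fun B : Matrix X X ℂ => B *ᵥ v) '' (boseMesner Γ : Set (Matrix X X ℂ)) ∧
      LinearIndependent ℂ
        (fun i : {i : ℕ // 1 ≤ i ∧ i ≤ Γ.diam - 1 ∧ i ≠ d} => primIdem Γ i *ᵥ v) ∧
      Submodule.span ℂ (Set.range
        (fun i : {i : ℕ // 1 ≤ i ∧ i ≤ Γ.diam - 1 ∧ i ≠ d} => primIdem Γ i *ᵥ v)) = W ∧
      primIdem Γ 0 *ᵥ v = 0 ∧ primIdem Γ d *ᵥ v = 0 ∧ primIdem Γ Γ.diam *ᵥ v = 0) := by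
  have hconn := hΓ.connected
  have hW := hirr.isTModule
  have h0 : act (dualIdem Γ x 0) W = ⊥ := act_dualIdem_of_lt_endpoint (by omega) (by omega)
  have h1 : act (dualIdem Γ x 1) W = ⊥ := act_dualIdem_of_lt_endpoint (by omega) (by omega)
  have hη3 : η = (bNum Γ p 3 : ℂ) - 1 := by
    rw [theta_middle hΓ hbip hd, Complex.ofReal_zero,
      tilde_zero (bNum_pos hΓ (by omega)).ne'] at hηd
    exact OnePoint.coe_injective hηd
  subst hη3
  have hMv : ∀ v ∈ act (dualIdem Γ x 2) W, v ≠ 0 → ∀ w ∈ W, ∃ B ∈ boseMesner Γ, B *ᵥ v = w :=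
    fun v hv hv0 w hw => exists_boseMesner_mulVec_eq hconn hbip hirr hthin hv hv0 h1 hw
  have hker : ∀ v ∈ act (dualIdem Γ x 2) W, v ≠ 0 → ∀ i ≤ Γ.diam,
      (primIdem Γ i *ᵥ v = 0 ↔ i = 0 ∨ i = d ∨ i = Γ.diam) := fun v hv hv0 i hi =>
    (primIdem_mulVec_eq_zero_iff hΓ hbip hD hv0 ((mem_act_dualIdem_iff hconn hW).1 hv).2
      (sum_eq_zero_of_act_zero hΓ hbip (by omega) hW h0 hv) (hη.2 v hv) hi).trans
      (theta_polynomial_eq_zero_iff hΓ hbip (by omega) hd hi)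
  have hli : ∀ v ∈ act (dualIdem Γ x 2) W, v ≠ 0 → LinearIndependent ℂ
      (fun i : {i : ℕ // 1 ≤ i ∧ i ≤ Γ.diam - 1 ∧ i ≠ d} => primIdem Γ i *ᵥ v) :=
    fun v hv hv0 => linearIndependent_primIdem_mulVec hΓ (fun i hi => by omega)
      fun i hi h => by
        have := (hker v hv hv0 i (by omega)).1 h
        omega
  have hspan : ∀ v ∈ act (dualIdem Γ x 2) W, v ≠ 0 → Submodule.span ℂ (Set.range
      (fun i : {i : ℕ // 1 ≤ i ∧ i ≤ Γ.diam - 1 ∧ i ≠ d} => primIdem Γ i *ᵥ v)) = W := by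
    intro v hv hv0
    apply le_antisymm
    · rw [Submodule.span_le]
      rintro _ ⟨i, rfl⟩
      exact hW _ (boseMesner_le x (primIdem_mem_boseMesner i)) _
        ((mem_act_dualIdem_iff hconn hW).1 hv).1
    · intro w hw
      obtain ⟨B, hB, rfl⟩ := hMv v hv hv0 w hw
      exact mulVec_mem_span_primIdem hΓ
        (fun i hi hq => (hker v hv hv0 i hi).2 (by omega)) hB
  obtain ⟨v, hv, hv0⟩ := Submodule.exists_mem_ne_zero_of_ne_bot hη.1
  have hvW := ((mem_act_dualIdem_iff hconn hW).1 hv).1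
  have hrank : Module.finrank ℂ W = Γ.diam - 2 := by
    rw [← finrank_span_primIdem_mulVec hd hD (hli v hv hv0), hspan v hv hv0]
  have hraise := raise_ne_zero_iff hconn hbip hirr hthin hv hv0 h1
  have hact := act_dualIdem_eq_span_raise hconn hbip hirr hthin hv hv0 h1
  refine ⟨hrank, fun i hi => ⟨?_, fun hi2 hiD => ?_⟩, fun i hi => ⟨?_, fun hi1 hiD hid => ?_⟩,
    fun u hu hu0 => ⟨?_, hli u hu hu0, hspan u hu hu0, ?_, ?_, ?_⟩⟩
  · rintro (rfl | rfl | rfl)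
    · exact h0
    · exact h1
    -- E_D^*W is spanned by R^{D-2}v, the first raised vector to vanish since dim W = D - 2.
    · have h := hact (Γ.diam - 2)
      rw [Nat.sub_add_cancel (by omega)] at h
      rw [h, Submodule.span_singleton_eq_bot]
      by_contra hne
      have := (hraise _).1 hne
      omega
  · obtain ⟨j, rfl⟩ := Nat.exists_eq_add_of_le' hi2
    rw [hact j]
    exact finrank_span_singleton ((hraise j).2 (by omega))
  · intro hmem
    rw [act_primIdem_eq_span hvW (hMv v hv hv0), Submodule.span_singleton_eq_bot]
    exact (hker v hv hv0 i hi).2 hmem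
  · rw [act_primIdem_eq_span hvW (hMv v hv hv0)]
    refine finrank_span_singleton fun h => ?_
    have := (hker v hv hv0 i hi).1 h
    omega
  · ext w
    constructor
    · exact fun hw => hMv u hu hu0 w hw
    · rintro ⟨B, hB, rfl⟩
      exact hW _ (boseMesner_le x hB) _ ((mem_act_dualIdem_iff hconn hW).1 hu).1
  · exact (hker u hu hu0 0 (by omega)).2 (by omega)
  · exact (hker u hu hu0 d (by omega)).2 (by omega)
  · exact (hker u hu hu0 _ le_rfl).2 (by omega)
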